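/- For a positive integer $n$ let $Q_n$ be the hypercube graph: its vertex set is $\{0,1\}^n$, and two vertices are adjacent if and only if they differ in precisely one coordinate. For a natural number $c$, a $c$-additive spanner of $Q_n$ is a subgraph $G\subseteq Q_n$ with vertex set $\{0,1\}^n$ such that $\operatorname{dist}_G(x,y)\le \operatorname{dist}_{Q_n}(x,y)+c$ for all $x,y\in\{0,1\}^n$ (with $\operatorname{dist}_G(x,y)=\infty$ if $x$ and $y$ lie in different components of $G$). Let $\ln^{(j)}$ denote the $j$-fold iterated natural logarithm, defined by $\ln^{(1)} x=\ln x$ and $\ln^{(j+1)} x=\ln\bigl(\ln^{(j)} x\bigr)$. Theorem. For every integer $k\ge 0$ there is $n_0=n_0(k)$ such that for every $n\ge n_0$ the hypercube $Q_n$ has a $2k$-additive spanner with maximum degree at most $$10^{4k}\,\frac{n\,\ln^{(k+1)} n}{\ln n}.$$ -/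

import Mathlib

/-- The hypercube graph `Q_n`: the vertices are the binary vectors of length `n`, and two of them
are adjacent when they differ in precisely one coordinate. -/
def hypercube (n : ℕ) : SimpleGraph (Fin n → Bool) where
  Adj x y := hammingDist x y = 1
  symm := ⟨fun x y h => by rw [hammingDist_comm]; exact h⟩
  loopless := ⟨fun x h => by simp at h⟩

/-- `G` is a `c`-additive spanner of `H`: a (spanning) subgraph of `H` in which the distance between
any two vertices is at most `c` larger than in `H`. Distances are extended distances, so two
vertices in different components are at distance `⊤`. -/
def IsAdditiveSpanner {V : Type*} (c : ℕ) (G H : SimpleGraph V) : Prop :=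
  G ≤ H ∧ ∀ x y : V, G.edist x y ≤ H.edist x y + (c : ℕ∞)

/-- The iterated natural logarithm: `iterLog 1 x = log x`, `iterLog (j + 1) x = log (iterLog j x)`
(with `iterLog 0 x = x`). -/
noncomputable def iterLog : ℕ → ℝ → ℝ
  | 0, x => x
  | j + 1, x => Real.log (iterLog j x)

/-!
For `k = 0` the hypercube itself qualifies. For every `k ≥ 1` one spanner with additive error two and
maximum degree `O(n / log n)` does, since `log` iterated `k + 1` times tends to infinity
(`exists_isAdditiveSpanner_two`, `degree_bound_le`).

Let `m` be about `(log n) / 6`. Set aside `8 ^ m ≤ √n` *free* coordinates, all of whose edges are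
kept, and split the others evenly into `m` classes. The *state* of a vertex is the vector in `𝔽₂ ^ m`
of its parities on the classes, so that flipping a coordinate of class `c` moves the state along
direction `c` of the `m`-dimensional cube. The free coordinates are indexed by the triples of states,
and the *label* of a vertex is the sum of the triples at the free coordinates in its support. As in a
Hamming code, every label can be reached from every vertex by flipping one free coordinate, and flips
within the classes do not change it. A label `(P, R, Q)` names a route: the canonical geodesic of the
small cube from `P` to `R` and then that from `R` to `Q`. At a vertex with this label exactly those
non-free edges are kept whose image in the small cube lies on the route. A path has at most two edges
at each vertex, so only four classes contribute to a degree (`degree_spanner_le`).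

To go from `x` to `y`, choose `z` between them such that from `x` to `z`, and from `z` to `y`, each
class either does not change at all or changes its parity (`exists_intermediate`). One free flip
produces the label made of the states of `x`, `z` and `y`. Then the classes can be corrected one after
the other along the route, without detour: an odd number of flips within one class goes back and
forth along one edge of the geodesic and ends at its far end (`edist_le_of_onGeodesic`). Correcting
the free coordinates, including the one flipped at the start, brings the detour to at most two
(`isAdditiveSpanner_spanner`).
-/

namespace HypercubeSpanner

open Finset Filter

/-! ### Flips and syndromes -/

/-- The neighbour of `x` in direction `i`. -/
def flip {n : ℕ} (x : Fin n → Bool) (i : Fin n) : Fin n → Bool :=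
  Function.update x i (!x i)

section Flip

variable {n : ℕ} (x : Fin n → Bool) (i : Fin n)

@[simp] lemma flip_self : flip x i i = !x i := by simp [flip]

lemma flip_of_ne {j : Fin n} (h : j ≠ i) : flip x i j = x j := by simp [flip, h]

@[simp] lemma flip_flip : flip (flip x i) i = x := by simp [flip]

lemma flip_injective : Function.Injective (flip x) := by
  intro i j h
  by_contra hij
  have := congrFun h i
  rw [flip_self, flip_of_ne x j hij] at this
  simp at this

lemma hammingDist_flip : hammingDist x (flip x i) = 1 := by
  rw [hammingDist, Finset.card_eq_one]
  refine ⟨i, ?_⟩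
  ext j
  by_cases h : j = i
  · subst h; simp
  · simp [h, flip_of_ne]

lemma exists_eq_flip {x y : Fin n → Bool} (h : hammingDist x y = 1) : ∃ i, y = flip x i := by
  rw [hammingDist, Finset.card_eq_one] at h
  obtain ⟨i, hi⟩ := h
  refine ⟨i, funext fun j => ?_⟩
  have hj := Finset.ext_iff.1 hi j
  by_cases h : j = i
  · subst h
    simp only [mem_filter, mem_univ, true_and, mem_singleton, iff_true] at hj
    rw [flip_self]
    cases hx : x j <;> cases hy : y j <;> simp_all
  · rw [flip_of_ne x i h]
    simp only [mem_filter, mem_univ, true_and, mem_singleton, h, iff_false, not_not] at hj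
    exact hj.symm

/-- Flipping a coordinate in which `x` and `y` differ brings `x` one step closer to `y`. -/
lemma hammingDist_flip_left {x y : Fin n → Bool} {i : Fin n} (h : x i ≠ y i) :
    hammingDist x y = hammingDist (flip x i) y + 1 := by
  have : ({j | x j ≠ y j} : Finset (Fin n)) =
      insert i ({j | flip x i j ≠ y j} : Finset (Fin n)) := by
    ext j
    by_cases hj : j = i
    · subst hj; simp [h]
    · simp [hj, flip_of_ne]
  have hi : i ∉ ({j | flip x i j ≠ y j} : Finset (Fin n)) := by
    cases hx : x i <;> cases hy : y i <;> simp_all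
  calc hammingDist x y = #(insert i ({j | flip x i j ≠ y j} : Finset (Fin n))) :=
        congrArg card this
    _ = hammingDist (flip x i) y + 1 := card_insert_of_notMem hi

/-- Coordinatewise betweenness means lying on a geodesic of the hypercube. -/
lemma hammingDist_add_of_between {x y z : Fin n → Bool} (h : ∀ i, z i = x i ∨ z i = y i) :
    hammingDist x z + hammingDist z y = hammingDist x y := by
  simp only [hammingDist, card_filter, ← sum_add_distrib]
  refine sum_congr rfl fun i _ => ?_
  rcases h i with h | h <;> simp [h]

/-- The sum of the vectors `s i` over the coordinates `i` in the support of `x`. -/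
def syndrome {V : Type*} [AddCommMonoid V] (s : Fin n → V) (x : Fin n → Bool) : V :=
  ∑ i, if x i then s i else 0

lemma syndrome_flip {V : Type*} [AddCommMonoid V] (hV : ∀ v : V, v + v = 0) (s : Fin n → V) :
    syndrome s (flip x i) = syndrome s x + s i := by
  unfold syndrome
  rw [← add_sum_erase univ _ (mem_univ i), ← add_sum_erase univ (fun j => if x j then s j else 0)
    (mem_univ i)]
  have : ∑ j ∈ univ.erase i, (if flip x i j then s j else 0) =
      ∑ j ∈ univ.erase i, if x j then s j else 0 :=
    sum_congr rfl fun j hj => by rw [flip_of_ne x i (ne_of_mem_erase hj)]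
  rw [this, flip_self]
  cases x i
  · simp [add_comm]
  · simp [add_right_comm, hV]

end Flip

/-! ### The spanner -/

section Spanner

variable {n m : ℕ} (cls : Fin n → Option (Fin m)) (lab : Fin n → Fin 3 → Fin m → ZMod 2)

/-- The state of `x`: the parities of `x` on the `m` classes of coordinates, class `c` consisting of
the coordinates `i` with `cls i = some c`. The coordinates with `cls i = none` are the free ones. -/
def parity (x : Fin n → Bool) : Fin m → ZMod 2 :=
  syndrome (fun i c => if cls i = some c then 1 else 0) x

/-- The label of `x`, a triple of states, which depends on the free coordinates of `x` only. -/
def label (x : Fin n → Bool) : Fin 3 → Fin m → ZMod 2 :=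
  syndrome (fun i => if cls i = none then lab i else 0) x

/-- The edge in direction `c` at the state `R` belongs to the canonical geodesic from `P` to `Q`,
which corrects the coordinates in increasing order. -/
def OnGeodesic (P Q R : Fin m → ZMod 2) (c : Fin m) : Prop :=
  P c ≠ Q c ∧ (∀ b < c, R b = Q b) ∧ ∀ b, c < b → R b = P b

/-- The edge in direction `i` at `x` is kept: either `i` is free, or the move that it induces on
states follows one of the two geodesics described by the label of `x`. -/
def Kept (x : Fin n → Bool) (i : Fin n) : Prop :=
  ∀ c, cls i = some c →
    OnGeodesic (label cls lab x 0) (label cls lab x 1) (parity cls x) c ∨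
    OnGeodesic (label cls lab x 1) (label cls lab x 2) (parity cls x) c

lemma parity_flip (x : Fin n → Bool) (i : Fin n) (c : Fin m) :
    parity cls (flip x i) c = parity cls x c + if cls i = some c then 1 else 0 := by
  unfold parity
  rw [syndrome_flip x i (fun v => funext fun c => CharTwo.add_self_eq_zero (v c))]
  rfl

lemma parity_congr {x y : Fin n → Bool} {c : Fin m} (h : ∀ i, cls i = some c → x i = y i) :
    parity cls x c = parity cls y c := by
  simp only [parity, syndrome, Finset.sum_apply]
  refine sum_congr rfl fun i _ => ?_
  by_cases hi : cls i = some c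
  · rw [h i hi]
  · cases x i <;> cases y i <;> simp [hi]

lemma label_flip (x : Fin n → Bool) (i : Fin n) :
    label cls lab (flip x i) = label cls lab x + if cls i = none then lab i else 0 :=
  syndrome_flip x i (fun v => funext fun a => funext fun c => CharTwo.add_self_eq_zero (v a c)) _

lemma label_congr {x y : Fin n → Bool} (h : ∀ i, cls i = none → x i = y i) :
    label cls lab x = label cls lab y := by
  unfold label syndrome
  refine sum_congr rfl fun i _ => ?_
  by_cases hi : cls i = none
  · rw [h i hi]
  · simp [hi]

variable {cls lab} in
lemma Kept.flip {x : Fin n → Bool} {i : Fin n} (h : Kept cls lab x i) :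
    Kept cls lab (flip x i) i := by
  intro c hc
  have hl : label cls lab (HypercubeSpanner.flip x i) = label cls lab x := by
    simp [label_flip, hc]
  have hp : ∀ b, b ≠ c → parity cls (HypercubeSpanner.flip x i) b = parity cls x b := by
    intro b hb
    simp [parity_flip, hc, hb.symm]
  rw [hl]
  refine (h c hc).imp ?_ ?_ <;> rintro ⟨h0, h1, h2⟩ <;>
    exact ⟨h0, fun b hb => (hp b hb.ne).trans (h1 b hb), fun b hb => (hp b hb.ne').trans (h2 b hb)⟩

/-- The subgraph of the hypercube formed by the kept edges. -/
def spanner : SimpleGraph (Fin n → Bool) where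
  Adj x y := ∃ i, y = flip x i ∧ Kept cls lab x i
  symm := ⟨by
    rintro x _ ⟨i, rfl, h⟩
    exact ⟨i, (flip_flip x i).symm, h.flip⟩⟩
  loopless := ⟨by
    rintro x ⟨i, h, -⟩
    have := congrFun h i
    rw [flip_self] at this
    simp at this⟩

lemma spanner_le : spanner cls lab ≤ hypercube n := by
  rintro x _ ⟨i, rfl, -⟩
  exact hammingDist_flip x i

/-! ### Degrees -/

lemma degree_le_of_flip (G : SimpleGraph (Fin n → Bool)) [DecidableRel G.Adj] (x : Fin n → Bool)
    (s : Finset (Fin n)) (h : ∀ y, G.Adj x y → ∃ i ∈ s, y = flip x i) : G.degree x ≤ #s := by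
  rw [← SimpleGraph.card_neighborFinset_eq_degree, ← card_map ⟨flip x, flip_injective x⟩]
  refine card_le_card fun y hy => ?_
  obtain ⟨i, hi, rfl⟩ := h y ((G.mem_neighborFinset x y).1 hy)
  exact mem_map_of_mem _ hi

/-- A path has at most two edges at each of its vertices. -/
lemma card_onGeodesic_le (P Q R : Fin m → ZMod 2) [DecidablePred (OnGeodesic P Q R)] :
    #{c | OnGeodesic P Q R c} ≤ 2 := by
  by_contra! h
  -- A direction strictly between two others would have to be both corrected and uncorrected.
  have key : ∀ a b c, OnGeodesic P Q R a → OnGeodesic P Q R b → OnGeodesic P Q R c →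
      a < b → b < c → False := fun a b c ha hb hc hab hbc =>
    hb.1 ((ha.2.2 b hab).symm.trans (hc.2.1 b hbc))
  obtain ⟨a, b, c, ha, hb, hc, hab, hac, hbc⟩ := two_lt_card.1 h
  simp only [mem_filter, mem_univ, true_and] at ha hb hc
  rcases lt_or_gt_of_ne hab with h1 | h1 <;> rcases lt_or_gt_of_ne hac with h2 | h2 <;>
    rcases lt_or_gt_of_ne hbc with h3 | h3 <;> grind

lemma degree_spanner_le [DecidableRel (spanner cls lab).Adj] {a s : ℕ}
    (ha : #{i | cls i = none} ≤ a) (hs : ∀ c, #{i | cls i = some c} ≤ s) (x : Fin n → Bool) :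
    (spanner cls lab).degree x ≤ a + 4 * s := by
  classical
  set C₁ : Finset (Fin m) :=
    {c | OnGeodesic (label cls lab x 0) (label cls lab x 1) (parity cls x) c}
  set C₂ : Finset (Fin m) :=
    {c | OnGeodesic (label cls lab x 1) (label cls lab x 2) (parity cls x) c}
  have hC : #(C₁ ∪ C₂) ≤ 4 :=
    (card_union_le _ _).trans (add_le_add (card_onGeodesic_le _ _ _) (card_onGeodesic_le _ _ _))
  calc (spanner cls lab).degree x
      ≤ #(({i | cls i = none} : Finset (Fin n)) ∪
          (C₁ ∪ C₂).biUnion fun c => {i | cls i = some c}) := by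
        refine degree_le_of_flip _ x _ ?_
        rintro y ⟨i, hy, hi⟩
        refine ⟨i, ?_, hy⟩
        cases hc : cls i with
        | none => simp [hc]
        | some c => simpa [hc, C₁, C₂] using hi c hc
    _ ≤ #{i | cls i = none} + #(C₁ ∪ C₂) * s :=
        (card_union_le _ _).trans (add_le_add le_rfl (card_biUnion_le_card_mul _ _ _ fun c _ => hs c))
    _ ≤ a + 4 * s := add_le_add ha (Nat.mul_le_mul_right s hC)

/-! ### Distances -/

lemma hammingDist_le_edist (x y : Fin n → Bool) :
    (hammingDist x y : ℕ∞) ≤ (hypercube n).edist x y := by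
  refine le_iInf fun w => ?_
  rw [Nat.cast_le]
  induction w with
  | nil => simp
  | cons h _ ih =>
    rw [SimpleGraph.Walk.length_cons, add_comm]
    exact (hammingDist_triangle _ _ _).trans (add_le_add (le_of_eq h) ih)

lemma edist_flip_le {x : Fin n → Bool} {i : Fin n} (h : Kept cls lab x i) :
    (spanner cls lab).edist x (flip x i) ≤ 1 :=
  by
  have : (spanner cls lab).Adj x (flip x i) := ⟨i, rfl, h⟩
  exact (SimpleGraph.edist_eq_one_iff_adj.2 this).le

lemma edist_le_of_eq_on_classes {x y : Fin n → Bool}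
    (h : ∀ i, cls i ≠ none → x i = y i) :
    (spanner cls lab).edist x y ≤ hammingDist x y := by
  induction hd : hammingDist x y generalizing x with
  | zero => simp [eq_of_hammingDist_eq_zero hd]
  | succ d ih =>
    obtain ⟨i, hi⟩ : ∃ i, x i ≠ y i := by
      by_contra! hxy
      simp [funext hxy] at hd
    have hfree : cls i = none := by
      by_contra hc
      exact hi (h i hc)
    have hd' : hammingDist (flip x i) y = d := by
      have := hammingDist_flip_left hi
      omega
    have h1 := ih (x := flip x i) (fun j hj => by
      rw [flip_of_ne x i (by rintro rfl; exact hj hfree), h j hj]) hd'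
    refine SimpleGraph.edist_triangle.trans
      ((add_le_add (edist_flip_le cls lab (fun c hc => by simp [hfree] at hc)) h1).trans ?_)
    rw [Nat.cast_add, Nat.cast_one, add_comm]

/-- If all directions on the canonical geodesic from `P` to the state of `y` are kept as long as the
free coordinates agree with those of `y`, then `y` can be reached without detour: the classes are
corrected in increasing order, and the moves within a class go back and forth along a single edge
of the geodesic. -/
lemma edist_le_of_onGeodesic {x y : Fin n → Bool} {P : Fin m → ZMod 2}
    (hkept : ∀ z : Fin n → Bool, (∀ i, cls i = none → z i = y i) → ∀ i c, cls i = some c →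
      OnGeodesic P (parity cls y) (parity cls z) c → Kept cls lab z i)
    (hfree : ∀ i, cls i = none → x i = y i)
    (hne : ∀ i c, cls i = some c → x i ≠ y i → P c ≠ parity cls y c)
    (hP : ∀ i c, cls i = some c → x i ≠ y i → ∀ b, c < b → parity cls x b = P b) :
    (spanner cls lab).edist x y ≤ hammingDist x y := by
  induction hd : hammingDist x y generalizing x with
  | zero => simp [eq_of_hammingDist_eq_zero hd]
  | succ d ih =>
    obtain ⟨i₀, hi₀⟩ : ∃ i, x i ≠ y i := by
      by_contra! hxy
      simp [funext hxy] at hd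
    -- Pick a differing coordinate in the least possible class; the value `0` below is never used.
    obtain ⟨i, hi, hmin⟩ := exists_min_image ({i | x i ≠ y i} : Finset (Fin n))
      (fun i => (cls i).elim 0 Fin.val) ⟨i₀, by simpa using hi₀⟩
    simp only [mem_filter, mem_univ, true_and] at hi hmin
    obtain ⟨c, hc⟩ := Option.ne_none_iff_exists'.1 fun h => hi (hfree i h)
    have hmin' : ∀ i' c', cls i' = some c' → x i' ≠ y i' → c ≤ c' := fun i' c' hc' hne' => by
      simpa [hc, hc'] using hmin i' hne'
    have hstep : Kept cls lab x i := by
      refine hkept x hfree i c hc ⟨hne i c hc hi, fun b hb => ?_, hP i c hc hi⟩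
      refine parity_congr cls fun i' hi' => ?_
      by_contra hne'
      exact absurd (hmin' i' b hi' hne') (not_le.2 hb)
    have hdiff : ∀ i', flip x i i' ≠ y i' → x i' ≠ y i' := by
      intro i' hi'
      by_cases h : i' = i
      · rwa [h]
      · rwa [flip_of_ne x i h] at hi'
    have hd' : hammingDist (flip x i) y = d := by
      have := hammingDist_flip_left hi
      omega
    have h1 := ih (x := flip x i)
      (fun i' hi' => by
        rw [flip_of_ne x i (by rintro rfl; simp [hc] at hi'), hfree i' hi'])
      (fun i' c' hc' hne' => hne i' c' hc' (hdiff i' hne'))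
      (fun i' c' hc' hne' b hb => by
        have hcb : c < b := (hmin' i' c' hc' (hdiff i' hne')).trans_lt hb
        rw [parity_flip, hc, if_neg (by simpa using hcb.ne), add_zero]
        exact hP i' c' hc' (hdiff i' hne') b hb)
      hd'
    refine SimpleGraph.edist_triangle.trans
      ((add_le_add (edist_flip_le cls lab hstep) h1).trans ?_)
    rw [Nat.cast_add, Nat.cast_one, add_comm]

/-- There is a vertex `z` on a geodesic from `x` to `y` such that in each class the three vertices
`x`, `z`, `y` change parity whenever they change at all. A class in which `x` and `y` differ but have
the same parity is split into all but one of its changes and the remaining one. -/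
lemma exists_intermediate (x y : Fin n → Bool) :
    ∃ z : Fin n → Bool, (∀ i, z i = x i ∨ z i = y i) ∧ (∀ i, cls i = none → z i = x i) ∧
      ∀ i c, cls i = some c → (x i ≠ z i → parity cls x c ≠ parity cls z c) ∧
        (z i ≠ y i → parity cls z c ≠ parity cls y c) := by
  have key : ∀ c, ∃ z : Fin n → Bool, (∀ i, z i = x i ∨ z i = y i) ∧
      ∀ i, cls i = some c → (x i ≠ z i → parity cls x c ≠ parity cls z c) ∧
        (z i ≠ y i → parity cls z c ≠ parity cls y c) := by
    intro c
    by_cases hxy : parity cls x c = parity cls y c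
    · by_cases h : ∃ i, cls i = some c ∧ x i ≠ y i
      · obtain ⟨i, hi, hne⟩ := h
        have hpar : parity cls (flip y i) c ≠ parity cls y c := by simp [parity_flip, hi]
        refine ⟨flip y i, fun j => ?_, fun j _ => ⟨fun _ => hxy ▸ hpar.symm, fun _ => hpar⟩⟩
        by_cases hj : j = i
        · subst hj
          rw [flip_self]
          cases hx : x j <;> cases hy : y j <;> simp_all
        · exact Or.inr (flip_of_ne y i hj)
      · push Not at h
        exact ⟨y, fun _ => Or.inr rfl, fun i hi => ⟨fun hne => absurd (h i hi) hne, by simp⟩⟩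
    · exact ⟨y, fun _ => Or.inr rfl, fun i _ => ⟨fun _ => hxy, by simp⟩⟩
  choose z hz hpar using key
  refine ⟨fun i => (cls i).elim (x i) fun c => z c i, fun i => ?_, fun i hi => by simp [hi], ?_⟩
  · rcases hi : cls i with _ | c
    · exact Or.inl (by simp [hi])
    · simpa [hi] using hz c i
  · intro i c hi
    have : parity cls (fun i => (cls i).elim (x i) fun c => z c i) c = parity cls (z c) c :=
      parity_congr cls fun j hj => by simp [hj]
    rw [this]
    simpa [hi] using hpar c i hi

/-- If every label can be realized by flipping one free coordinate, then the spanner has additive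
error at most two: flip a free coordinate to obtain the label describing the route, follow the
route, and correct the free coordinates at the end. -/
lemma isAdditiveSpanner_spanner (hlab : ∀ v, ∃ i, cls i = none ∧ lab i = v) :
    IsAdditiveSpanner 2 (spanner cls lab) (hypercube n) := by
  refine ⟨spanner_le cls lab, fun x y => ?_⟩
  obtain ⟨z, hz, hzfree, hzpar⟩ := exists_intermediate cls x y
  set L : Fin 3 → Fin m → ZMod 2 := ![parity cls x, parity cls z, parity cls y] with hL
  obtain ⟨j, hj, hjlab⟩ := hlab (L - label cls lab x)
  set x₁ := flip x j with hx₁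
  -- The intermediate vertices carry the free coordinates of `x₁`.
  let z₁ : Fin n → Bool := fun i => if cls i = none then x₁ i else z i
  let y₁ : Fin n → Bool := fun i => if cls i = none then x₁ i else y i
  have hx₁c : ∀ i c, cls i = some c → x₁ i = x i := fun i c hi =>
    flip_of_ne x j (by rintro rfl; simp [hj] at hi)
  have hz₁c : ∀ i c, cls i = some c → z₁ i = z i := fun i c hi => by simp [z₁, hi]
  have hy₁c : ∀ i c, cls i = some c → y₁ i = y i := fun i c hi => by simp [y₁, hi]
  have hz₁f : ∀ i, cls i = none → z₁ i = x₁ i := fun i hi => by simp [z₁, hi]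
  have hy₁f : ∀ i, cls i = none → y₁ i = x₁ i := fun i hi => by simp [y₁, hi]
  have hxp : parity cls x₁ = parity cls x := funext fun c => parity_congr cls fun i => hx₁c i c
  have hzp : parity cls z₁ = parity cls z := funext fun c => parity_congr cls fun i => hz₁c i c
  have hyp : parity cls y₁ = parity cls y := funext fun c => parity_congr cls fun i => hy₁c i c
  have hlabel : ∀ w : Fin n → Bool, (∀ i, cls i = none → w i = x₁ i) → label cls lab w = L := by
    intro w hw
    rw [label_congr cls lab hw, hx₁, label_flip, if_pos hj, hjlab, add_sub_cancel]
  have h1 : (spanner cls lab).edist x x₁ ≤ 1 :=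
    edist_flip_le cls lab fun c hc => by simp [hj] at hc
  have h2 : (spanner cls lab).edist x₁ z₁ ≤ hammingDist x₁ z₁ := by
    refine edist_le_of_onGeodesic cls lab (P := parity cls x) ?_ (fun i hi => (hz₁f i hi).symm) ?_ ?_
    · intro w hw i c hi h c' hc'
      obtain rfl : c = c' := Option.some.inj (hi.symm.trans hc')
      rw [hlabel w fun i hi => (hw i hi).trans (hz₁f i hi)]
      left
      simpa [hL, hzp] using h
    · intro i c hi hne
      rw [hx₁c i c hi, hz₁c i c hi] at hne
      rw [hzp]
      exact (hzpar i c hi).1 hne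
    · intros
      rw [hxp]
  have h3 : (spanner cls lab).edist z₁ y₁ ≤ hammingDist z₁ y₁ := by
    refine edist_le_of_onGeodesic cls lab (P := parity cls z) ?_
      (fun i hi => (hz₁f i hi).trans (hy₁f i hi).symm) ?_ ?_
    · intro w hw i c hi h c' hc'
      obtain rfl : c = c' := Option.some.inj (hi.symm.trans hc')
      rw [hlabel w fun i hi => (hw i hi).trans (hy₁f i hi)]
      right
      simpa [hL, hyp] using h
    · intro i c hi hne
      rw [hz₁c i c hi, hy₁c i c hi] at hne
      rw [hyp]
      exact (hzpar i c hi).2 hne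
    · intros
      rw [hzp]
  have h4 : (spanner cls lab).edist y₁ y ≤ hammingDist y₁ y := by
    refine edist_le_of_eq_on_classes cls lab fun i hi => ?_
    obtain ⟨c, hc⟩ := Option.ne_none_iff_exists'.1 hi
    exact hy₁c i c hc
  have hd1 : hammingDist x₁ z₁ + hammingDist z₁ y₁ = hammingDist x₁ y₁ := by
    refine hammingDist_add_of_between fun i => ?_
    cases hi : cls i with
    | none => exact Or.inl (hz₁f i hi)
    | some c => rw [hx₁c i c hi, hz₁c i c hi, hy₁c i c hi]; exact hz i
  have hd2 : hammingDist x₁ y₁ + hammingDist y₁ y = hammingDist x₁ y := by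
    refine hammingDist_add_of_between fun i => ?_
    cases hi : cls i with
    | none => exact Or.inl (hy₁f i hi)
    | some c => exact Or.inr (hy₁c i c hi)
  have hd3 : hammingDist x₁ y ≤ 1 + hammingDist x y := by
    have := hammingDist_triangle x₁ x y
    rwa [hammingDist_comm x₁ x, hx₁, hammingDist_flip] at this
  calc (spanner cls lab).edist x y
      ≤ 1 + (hammingDist x₁ z₁ + (hammingDist z₁ y₁ + hammingDist y₁ y)) :=
        SimpleGraph.edist_triangle.trans (add_le_add h1 (SimpleGraph.edist_triangle.trans
          (add_le_add h2 (SimpleGraph.edist_triangle.trans (add_le_add h3 h4)))))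
    _ ≤ (hammingDist x y : ℕ∞) + (2 : ℕ) := by
        norm_cast
        omega
    _ ≤ (hypercube n).edist x y + (2 : ℕ) := add_le_add (hammingDist_le_edist x y) le_rfl

end Spanner

/-! ### The choice of parameters -/

lemma card_filter_mod_le (n m : ℕ) (c : ℕ) : #{i : Fin n | (i : ℕ) % m = c} ≤ n / m + 1 := by
  rw [← card_range (n / m + 1)]
  refine card_le_card_of_injOn (fun i => (i : ℕ) / m) (fun i _ => ?_) fun i hi j hj h => ?_
  · simpa [Nat.lt_succ_iff] using Nat.div_le_div_right i.2.le
  · simp only [mem_coe, mem_filter, mem_univ, true_and] at hi hj h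
    ext
    rw [← Nat.div_add_mod (i : ℕ) m, ← Nat.div_add_mod (j : ℕ) m, h, hi, hj]

/-- `8 ^ m` free coordinates suffice to realize all labels, since a label consists of `3 * m`
bits. -/
lemma exists_isAdditiveSpanner_two {n m : ℕ} (hm : 0 < m) (hn : 8 ^ m ≤ n) :
    ∃ (G : SimpleGraph (Fin n → Bool)) (_ : DecidableRel G.Adj),
      IsAdditiveSpanner 2 G (hypercube n) ∧ G.maxDegree ≤ 8 ^ m + 4 * (n / m + 1) := by
  classical
  have hcard : Fintype.card (Fin 3 → Fin m → ZMod 2) = 8 ^ m := by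
    simp only [Fintype.card_fun, ZMod.card, Fintype.card_fin]
    rw [← pow_mul, mul_comm, pow_mul]
    norm_num
  let e : Fin (8 ^ m) ≃ (Fin 3 → Fin m → ZMod 2) :=
    (finCongr hcard.symm).trans (Fintype.equivFin _).symm
  let cls : Fin n → Option (Fin m) := fun i =>
    if (i : ℕ) < 8 ^ m then none else some ⟨i % m, Nat.mod_lt _ hm⟩
  let lab : Fin n → Fin 3 → Fin m → ZMod 2 := fun i => if h : (i : ℕ) < 8 ^ m then e ⟨i, h⟩ else 0
  refine ⟨spanner cls lab, Classical.decRel _, ?_, ?_⟩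
  · refine isAdditiveSpanner_spanner cls lab fun v => ?_
    refine ⟨Fin.castLE hn (e.symm v), ?_, ?_⟩ <;> simp [cls, lab]
  · refine SimpleGraph.maxDegree_le_of_forall_degree_le _ _ (degree_spanner_le cls lab ?_ fun c => ?_)
    · rw [← card_range (8 ^ m)]
      refine card_le_card_of_injOn Fin.val (fun i hi => ?_) fun i _ j _ h => Fin.ext h
      simpa [cls] using hi
    · refine (card_le_card fun i => ?_).trans (card_filter_mod_le n m c)
      simp only [mem_filter, mem_univ, true_and, cls]
      split_ifs
      · simp
      · intro h
        exact congrArg Fin.val (Option.some.inj h)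

lemma tendsto_iterLog (j : ℕ) : Tendsto (iterLog j) atTop atTop := by
  induction j with
  | zero => exact tendsto_id
  | succ j ih => exact Real.tendsto_log_atTop.comp ih

lemma eight_pow_floor_le {x : ℝ} (hx0 : 0 < x) (hx : 0 ≤ Real.log x) :
    (8 : ℝ) ^ ⌊Real.log x / 6⌋₊ ≤ √x := by
  have h8 : Real.log 8 ≤ 3 := by
    have := Real.log_two_lt_d9
    rw [show (8 : ℝ) = 2 ^ 3 by norm_num, Real.log_pow]
    push_cast
    linarith
  have hm : (⌊Real.log x / 6⌋₊ : ℝ) ≤ Real.log x / 6 := Nat.floor_le (by positivity)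
  rw [← Real.log_le_log_iff (by positivity) (by positivity), Real.log_pow, Real.log_sqrt hx0.le]
  calc (⌊Real.log x / 6⌋₊ : ℝ) * Real.log 8 ≤ Real.log x / 6 * 3 := by gcongr
    _ = Real.log x / 2 := by ring

lemma degree_bound_le {x : ℝ} (hx0 : 0 < x) (hx : 12 ≤ Real.log x) :
    (8 : ℝ) ^ ⌊Real.log x / 6⌋₊ + 4 * (x / ⌊Real.log x / 6⌋₊ + 1) ≤
      10 ^ 4 * (x / Real.log x) := by
  have h1 := eight_pow_floor_le hx0 (by linarith)
  set L := Real.log x with hL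
  have hLpos : 0 < L := by linarith
  have hsqrt : √x ≤ 2 * (x / L) := by
    have h : L ≤ 2 * √x := by
      have := Real.log_le_sub_one_of_pos (Real.sqrt_pos.2 hx0)
      rw [Real.log_sqrt hx0.le] at this
      linarith
    rw [← mul_div_assoc, le_div_iff₀ hLpos]
    calc √x * L ≤ √x * (2 * √x) := by gcongr
      _ = 2 * x := by rw [mul_left_comm, Real.mul_self_sqrt hx0.le]
  have hdiv : x / ⌊L / 6⌋₊ ≤ 12 * (x / L) := by
    have hm : L / 12 ≤ ⌊L / 6⌋₊ := by
      have := Nat.lt_floor_add_one (L / 6)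
      linarith
    calc x / ⌊L / 6⌋₊ ≤ x / (L / 12) := by gcongr
      _ = 12 * (x / L) := by field_simp
  have hone : 1 ≤ x / L := by
    rw [one_le_div hLpos]
    exact (Real.log_le_sub_one_of_pos hx0).trans (by linarith)
  linarith

lemma degree_hypercube_le (n : ℕ) [DecidableRel (hypercube n).Adj] (x : Fin n → Bool) :
    (hypercube n).degree x ≤ n := by
  simpa using degree_le_of_flip (hypercube n) x univ fun y h =>
    (exists_eq_flip h).imp fun i hi => ⟨mem_univ i, hi⟩

end HypercubeSpanner

open HypercubeSpanner in
theorem theorem2 (k : ℕ) :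
    ∃ n₀ : ℕ, ∀ n : ℕ, n₀ ≤ n →
      ∃ (G : SimpleGraph (Fin n → Bool)) (_ : DecidableRel G.Adj),
        IsAdditiveSpanner (2 * k) G (hypercube n) ∧
        (G.maxDegree : ℝ) ≤ 10 ^ (4 * k) * ((n : ℝ) * iterLog (k + 1) n / Real.log n) := by
  rcases k.eq_zero_or_pos with rfl | hk
  · refine ⟨2, fun n hn => ⟨hypercube n, Classical.decRel _, ⟨le_rfl, fun x y => by simp⟩, ?_⟩⟩
    have hlog : Real.log n ≠ 0 := (Real.log_pos (by exact_mod_cast hn)).ne'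
    have h : (n : ℝ) * iterLog (0 + 1) n / Real.log n = n := mul_div_cancel_right₀ _ hlog
    rw [h, mul_zero, pow_zero, one_mul, Nat.cast_le]
    classical
    exact SimpleGraph.maxDegree_le_of_forall_degree_le _ _ fun x => degree_hypercube_le n x
  · have hlog : ∀ᶠ n : ℕ in Filter.atTop, 12 ≤ Real.log n :=
      (Real.tendsto_log_atTop.comp tendsto_natCast_atTop_atTop).eventually_ge_atTop 12
    have hiter : ∀ᶠ n : ℕ in Filter.atTop, 1 ≤ iterLog (k + 1) n :=
      ((tendsto_iterLog (k + 1)).comp tendsto_natCast_atTop_atTop).eventually_ge_atTop 1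
    obtain ⟨n₀, hn₀⟩ :=
      Filter.eventually_atTop.1 (hlog.and (hiter.and (Filter.eventually_ge_atTop 1)))
    refine ⟨n₀, fun n hn => ?_⟩
    obtain ⟨hl, hi, h1⟩ := hn₀ n hn
    have hn1 : (1 : ℝ) ≤ n := by exact_mod_cast h1
    have hm : 0 < ⌊Real.log n / 6⌋₊ := Nat.floor_pos.2 (by linarith)
    have h8 : 8 ^ ⌊Real.log n / 6⌋₊ ≤ n := by
      have h : (8 : ℝ) ^ ⌊Real.log n / 6⌋₊ ≤ n :=
        (eight_pow_floor_le (by linarith) (by linarith)).trans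
          (Real.sqrt_le_iff.2 ⟨by linarith, by nlinarith⟩)
      exact_mod_cast h
    obtain ⟨G, hdec, ⟨hle, hdist⟩, hdeg⟩ := exists_isAdditiveSpanner_two hm h8
    refine ⟨G, hdec, ⟨hle, fun x y => (hdist x y).trans (add_le_add le_rfl ?_)⟩, ?_⟩
    · exact_mod_cast (by omega : 2 ≤ 2 * k)
    · calc (G.maxDegree : ℝ)
          ≤ ((8 ^ ⌊Real.log n / 6⌋₊ + 4 * (n / ⌊Real.log n / 6⌋₊ + 1) : ℕ) : ℝ) := by
            exact_mod_cast hdeg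
        _ ≤ (8 : ℝ) ^ ⌊Real.log n / 6⌋₊ + 4 * (n / ⌊Real.log n / 6⌋₊ + 1) := by
            push_cast
            gcongr
            exact Nat.cast_div_le
        _ ≤ 10 ^ 4 * (n / Real.log n) := degree_bound_le (by linarith) hl
        _ ≤ 10 ^ (4 * k) * (n * iterLog (k + 1) n / Real.log n) := by
            have : (n : ℝ) ≤ n * iterLog (k + 1) n := le_mul_of_one_le_right (by linarith) hi
            gcongr
            · norm_num
            · omega
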